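/- Let $k>0$ be real and let $f$ be a nonzero holomorphic cusp form of weight $k$ on $SL_2(\mathbb Z)$, i.e. $f$ is holomorphic on the upper half plane $\mathbb H$, $f(\tau)\to0$ as $\operatorname{Im}\tau\to\infty$, for every $\gamma=\begin{pmatrix}a&b\\c&d\end{pmatrix}\in SL_2(\mathbb Z)$ with $c>0$ there is a number $A(\gamma)$ with $|A(\gamma)|=1$ such that $f\left(\frac{a\tau+b}{c\tau+d}\right)=A(\gamma)[-i(c\tau+d)]^kf(\tau)$ for all $\tau\in\mathbb H$ (principal power), and $f(\tau)=\sum_{n\ge1}a_ne^{2\pi in\tau}$ on $\mathbb H$ with not all $a_n$ zero. For real $x$ and integers $q,h\ge1$ put $$S(x;q,h)=\sum_{\substack{1\le n\le x\\ n\equiv h\ (\mathrm{mod}\ q)}}a_n,\qquad \hat S(x;q,h)=\sum_{\substack{1\le n\le x\\ n\equiv h\ (\mathrm{mod}\ q)}}\frac{a_n}{n^{(k-1)/2}}.$$ Then for $x^{1/2+\varepsilon}\le q\le x$ one has $\hat S(x;q,h)=O(x^{1/4})$ and $S(x;q,h)=O(x^{k/2-1/4})$ for almost all $1\le h\le q$.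 Precisely: there is a constant $C>0$ depending only on $f$ such that for all $\varepsilon>0$ and $\delta>0$ there is $x_0$ such that for all real $x\ge x_0$ and all integers $q$ with $x^{1/2+\varepsilon}\le q\le x$, all but at most $\delta q$ of the integers $1\le h\le q$ satisfy both $$|\hat S(x;q,h)|\le Cx^{1/4}\quad\text{and}\quad |S(x;q,h)|\le Cx^{k/2-1/4}.$$ -/

import Mathlib

open scoped MatrixGroups Manifold

noncomputable section

/-- `f` is a nonzero holomorphic cusp form of real weight `k` on `SL(2, ℤ)`, with a multiplier of
modulus one and period one, and `a n` (`n ≥ 1`) are its Fourier coefficients at infinity.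
The value `a 0` plays no role. The power `(-i(cτ+d))^k` is the principal one; since `c > 0`,
its base has positive real part. -/
structure IsCuspFormWithCoeffs (k : ℝ) (f : UpperHalfPlane → ℂ) (a : ℕ → ℂ) : Prop where
  weight_pos : 0 < k
  holomorphic : MDifferentiable 𝓘(ℂ) 𝓘(ℂ) f
  zero_at_infty : UpperHalfPlane.IsZeroAtImInfty f
  modular : ∀ γ : SL(2, ℤ), 0 < γ 1 0 → ∃ A : ℂ, ‖A‖ = 1 ∧ ∀ τ : UpperHalfPlane,
    f (γ • τ) =
      A * (-Complex.I * (((γ 1 0 : ℤ) : ℂ) * (τ : ℂ) + ((γ 1 1 : ℤ) : ℂ))) ^ (k : ℂ) * f τ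
  fourier : ∀ τ : UpperHalfPlane,
    HasSum (fun n : ℕ+ => a n * Complex.exp (2 * Real.pi * Complex.I * (n : ℂ) * (τ : ℂ))) (f τ)
  nonzero : ∃ n : ℕ, 1 ≤ n ∧ a n ≠ 0

/-- `S(x; q, h)`: the sum of `a n` over `1 ≤ n ≤ x` with `n ≡ h (mod q)`. -/
def progressionSum (a : ℕ → ℂ) (x : ℝ) (q h : ℕ) : ℂ :=
  ∑ n ∈ (Finset.Icc 1 ⌊x⌋₊).filter (fun n => n ≡ h [MOD q]), a n

/-- The normalized coefficients `a n / n ^ ((k - 1) / 2)`. -/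
def normalizedCoeff (k : ℝ) (a : ℕ → ℂ) (n : ℕ) : ℂ :=
  a n / (((n : ℝ) ^ ((k - 1) / 2) : ℝ) : ℂ)

/-- The residues `1 ≤ h ≤ q` for which at least one of the bounds
`|Ŝ(x; q, h)| ≤ C x^(1/4)`, `|S(x; q, h)| ≤ C x^(k/2 - 1/4)` fails. -/
def exceptionalResidues (k : ℝ) (a : ℕ → ℂ) (C x : ℝ) (q : ℕ) : Finset ℕ :=
  (Finset.Icc 1 q).filter (fun h =>
    ¬ (‖progressionSum (normalizedCoeff k a) x q h‖ ≤ C * x ^ (1 / 4 : ℝ) ∧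
      ‖progressionSum a x q h‖ ≤ C * x ^ (k / 2 - 1 / 4)))

end

/-!
The function `‖f τ‖ (im τ)^(k/2)` is `SL(2, ℤ)`-invariant and bounded at the cusp, so it is bounded
(Hecke). Cauchy's formula on the circle `‖w‖ = exp (-1/N)` writes `∑ n ≤ N, a n z^n` as the integral
of `f` against a geometric kernel whose `L¹` norm is `O(1 + log N)`; hence, uniformly in `‖z‖ = 1`,
this sum is `O(N^(k/2) (1 + log N))` (Wilton). Parseval on `ℤ/q` turns the uniform bound into
`∑ h ≤ q, ‖S(x; q, h)‖² = O(x^k log² x)`, so by Chebyshev `‖S(x; q, h)‖ > C x^(k/2 - 1/4)` for only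
`O(x^(1/2) log² x)` residues, which is `o(q)` once `q ≥ x^(1/2 + ε)`. Partial summation carries the
exponential sum bound, with exponent `1/2` in place of `k/2`, over to the normalized coefficients.
-/

open Filter Finset MeasureTheory UpperHalfPlane
open scoped Real

section GeometricKernel

lemma circleAverage_zpow {r : ℝ} (hr : 0 < r) (k : ℤ) :
    Real.circleAverage (fun w : ℂ => w ^ k) 0 r = if k = 0 then 1 else 0 := by
  split_ifs with hk
  · simp [hk, Real.circleAverage_const]
  · have hw : ∀ w ∈ Metric.sphere (0 : ℂ) r, (w - 0)⁻¹ • w ^ k = (w - 0) ^ (k - 1) := by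
      intro w hw
      rw [sub_zero, zpow_sub_one₀ (ne_zero_of_mem_sphere hr.ne' ⟨w, hw⟩), smul_eq_mul, mul_comm]
    rw [Real.circleAverage_eq_circleIntegral hr.ne', circleIntegral.integral_congr hr.le hw,
      circleIntegral.integral_sub_zpow_of_ne (by grind), smul_zero]

lemma circleAverage_pow_mul_sum_inv_pow {r : ℝ} (hr : 0 < r) (s : Finset ℕ) (n : ℕ) :
    Real.circleAverage (fun w : ℂ => w ^ n * ∑ m ∈ s, w⁻¹ ^ m) 0 r = if n ∈ s then 1 else 0 := by
  have hmul : Set.EqOn (fun w : ℂ => w ^ n * ∑ m ∈ s, w⁻¹ ^ m)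
      (fun w => ∑ m ∈ s, w ^ (n - m : ℤ)) (Metric.sphere 0 |r|) := by
    intro w hw
    have hw0 : w ≠ 0 := ne_zero_of_mem_sphere (abs_pos.2 hr.ne').ne' ⟨w, hw⟩
    simp only [mul_sum, zpow_sub₀ hw0, zpow_natCast, inv_pow, div_eq_mul_inv]
  rw [Real.circleAverage_congr_sphere hmul, Real.circleAverage_fun_sum fun m _ => ?_]
  · simp [circleAverage_zpow hr, sub_eq_zero]
  · have hne (θ : ℝ) : circleMap 0 r θ ≠ 0 := circleMap_ne_center hr.ne'
    exact ((continuous_circleMap 0 r).zpow₀ _ fun θ => .inl (hne θ)).intervalIntegrable _ _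

lemma sum_eq_circleAverage {c : ℕ → ℂ} {g : ℂ → ℂ} {r : ℝ} (hr : 0 < r)
    (hg : ∀ w : ℂ, ‖w‖ = r → HasSum (fun n => c n * w ^ n) (g w)) (s : Finset ℕ) :
    ∑ n ∈ s, c n = Real.circleAverage (fun w => g w * ∑ m ∈ s, w⁻¹ ^ m) 0 r := by
  have hnorm (θ : ℝ) : ‖circleMap 0 r θ‖ = r := by rw [norm_circleMap_zero, abs_of_pos hr]
  have hcoeff (n : ℕ) : Real.circleAverage (fun w => c n * w ^ n * ∑ m ∈ s, w⁻¹ ^ m) 0 r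
      = if n ∈ s then c n else 0 := by
    simp_rw [mul_assoc, ← smul_eq_mul (c n)]
    rw [Real.circleAverage_fun_smul, circleAverage_pow_mul_sum_inv_pow hr, smul_eq_mul, mul_ite,
      mul_one, mul_zero]
  have hsum : HasSum
      (fun n => Real.circleAverage (fun w => c n * w ^ n * ∑ m ∈ s, w⁻¹ ^ m) 0 r)
      (Real.circleAverage (fun w => g w * ∑ m ∈ s, w⁻¹ ^ m) 0 r) := by
    refine (intervalIntegral.hasSum_integral_of_dominated_convergence
      (fun n _ => ‖c n‖ * r ^ n * ∑ m ∈ s, r⁻¹ ^ m) (fun n => ?_) (fun n => ?_) ?_ ?_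
      ?_).const_smul (2 * π)⁻¹
    · simp only [circleMap_zero_inv]
      exact Continuous.aestronglyMeasurable (by fun_prop)
    · refine .of_forall fun θ _ => ?_
      rw [norm_mul, norm_mul, norm_pow, hnorm]
      gcongr
      exact norm_sum_le_of_le _ fun m _ => by rw [norm_pow, norm_inv, hnorm]
    · refine .of_forall fun θ _ => Summable.mul_right _ ?_
      simpa [abs_of_pos hr] using (hg r (by simp [hr.le])).summable.norm
    · exact intervalIntegrable_const
    · exact .of_forall fun θ _ => (hg _ (hnorm θ)).mul_right _
  simp only [hcoeff] at hsum
  rw [hsum.unique (hasSum_sum_of_ne_finset_zero fun n hn => if_neg hn), sum_ite_mem, inter_self]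

lemma circleAverage_eq_integral_neg_pi_pi {E : Type*} [NormedAddCommGroup E] [NormedSpace ℝ E]
    (g : ℂ → E) (c : ℂ) (r : ℝ) :
    Real.circleAverage g c r = (2 * π)⁻¹ • ∫ θ in -π..π, g (circleMap c r θ) := by
  rw [Real.circleAverage_eq_integral_add (-π),
    intervalIntegral.integral_comp_add_right (fun θ => g (circleMap c r θ))]
  ring_nf

lemma norm_sub_le_norm_smul_sub {F : Type*} [NormedAddCommGroup F] [InnerProductSpace ℝ F]
    {u v : F} (huv : ‖v‖ ≤ ‖u‖) {ρ : ℝ} (hρ : 1 ≤ ρ) : ‖u - v‖ ≤ ‖ρ • u - v‖ := by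
  refine le_of_sq_le_sq ?_ (norm_nonneg _)
  rw [norm_sub_sq_real, norm_sub_sq_real, real_inner_smul_left, norm_smul,
    Real.norm_of_nonneg (by linarith)]
  have hinner : inner ℝ u v ≤ ‖u‖ ^ 2 := (real_inner_le_norm u v).trans (by rw [sq]; gcongr)
  nlinarith [mul_nonneg (sub_nonneg.2 hρ) (sub_nonneg.2 hinner),
    mul_nonneg (mul_self_nonneg (ρ - 1)) (sq_nonneg ‖u‖)]

lemma mul_abs_le_norm_circleMap_sub_one {ρ θ : ℝ} (hρ : 1 ≤ ρ) (hθ : |θ| ≤ π) :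
    2 / π * |θ| ≤ ‖circleMap 0 ρ θ - 1‖ := by
  set u := Complex.exp (Complex.I * θ) with hu
  have hu1 : ‖(1 : ℂ)‖ ≤ ‖u‖ := by rw [hu, mul_comm, Complex.norm_exp_ofReal_mul_I, norm_one]
  have hsin : 2 / π * |θ / 2| ≤ |Real.sin (θ / 2)| :=
    Real.mul_abs_le_abs_sin (by rw [abs_div, abs_two]; gcongr)
  calc 2 / π * |θ| = 2 * (2 / π * |θ / 2|) := by rw [abs_div, abs_two]; ring
    _ ≤ 2 * |Real.sin (θ / 2)| := by gcongr
    _ = ‖u - 1‖ := by rw [hu, Complex.norm_exp_I_mul_ofReal_sub_one]; simp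
    _ ≤ ‖ρ • u - 1‖ := norm_sub_le_norm_smul_sub hu1 hρ
    _ = ‖circleMap 0 ρ θ - 1‖ := by rw [circleMap_zero, Complex.real_smul, hu, mul_comm Complex.I]

lemma norm_sum_Icc_pow_le {w : ℂ} {N : ℕ} (hw : ‖w‖ = Real.exp (1 / N)) :
    ‖∑ m ∈ Icc 1 N, w ^ m‖ ≤ Real.exp 1 * N := by
  have hterm : ∀ m ∈ Icc 1 N, ‖w ^ m‖ ≤ Real.exp 1 := by
    intro m hm
    rw [norm_pow, hw, ← Real.exp_nat_mul, mul_one_div]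
    gcongr
    exact div_le_one_of_le₀ (by exact_mod_cast (mem_Icc.1 hm).2) (by positivity)
  simpa [mul_comm] using norm_sum_le_of_le _ hterm

lemma norm_sum_Icc_pow_mul_norm_sub_one_le {w : ℂ} {N : ℕ} (hN : 1 ≤ N)
    (hw : ‖w‖ = Real.exp (1 / N)) :
    ‖∑ m ∈ Icc 1 N, w ^ m‖ * ‖w - 1‖ ≤ 2 * Real.exp 2 := by
  have hpow {m : ℕ} (hm : m ≤ 2 * N) : ‖w ^ m‖ ≤ Real.exp 2 := by
    rw [norm_pow, hw, ← Real.exp_nat_mul, mul_one_div]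
    gcongr
    exact div_le_of_le_mul₀ (by positivity) (by positivity) (by exact_mod_cast hm)
  rw [← norm_mul, ← Ico_add_one_right_eq_Icc, geom_sum_Ico_mul w (by lia)]
  linarith [norm_sub_le (w ^ (N + 1)) (w ^ 1), hpow (m := N + 1) (by lia), hpow (m := 1) (by lia)]

lemma norm_sum_Icc_circleMap_pow_le {N : ℕ} (hN : 1 ≤ N) {θ : ℝ} (hθ : |θ| ≤ π) :
    ‖∑ m ∈ Icc 1 N, circleMap 0 (Real.exp (1 / N)) θ ^ m‖
      ≤ 2 * π * Real.exp 2 * (N / (1 + N * |θ|)) := by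
  set w := circleMap 0 (Real.exp (1 / N)) θ
  have hw : ‖w‖ = Real.exp (1 / N) := by simp [w]
  set D := ‖∑ m ∈ Icc 1 N, w ^ m‖
  have hsmall : D ≤ π * Real.exp 2 * N := by
    refine (norm_sum_Icc_pow_le hw).trans ?_
    gcongr
    calc Real.exp 1 ≤ 1 * Real.exp 2 := by rw [one_mul]; gcongr; norm_num
      _ ≤ π * Real.exp 2 := by gcongr; linarith [Real.pi_gt_three]
  have hlarge : D * |θ| ≤ π * Real.exp 2 := by
    have hchord : 2 / π * |θ| ≤ ‖w - 1‖ :=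
      mul_abs_le_norm_circleMap_sub_one (Real.one_le_exp (by positivity)) hθ
    calc D * |θ| = π / 2 * (D * (2 / π * |θ|)) := by field_simp
      _ ≤ π / 2 * (D * ‖w - 1‖) := by gcongr
      _ ≤ π / 2 * (2 * Real.exp 2) := by
        gcongr π / 2 * ?_
        exact norm_sum_Icc_pow_mul_norm_sub_one_le hN hw
      _ = π * Real.exp 2 := by ring
  rw [← mul_div_assoc, le_div_iff₀ (by positivity)]
  nlinarith [mul_le_mul_of_nonneg_left hlarge N.cast_nonneg]

lemma integral_div_one_add_mul_abs {A r : ℝ} (hA : 0 ≤ A) (hr : 0 ≤ r) :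
    ∫ θ in -r..r, A / (1 + A * |θ|) = 2 * Real.log (1 + A * r) := by
  have hderiv : ∀ θ ∈ Set.uIcc 0 r,
      HasDerivAt (fun θ => Real.log (1 + A * θ)) (A / (1 + A * |θ|)) θ := by
    intro θ hθ
    have hθ0 : 0 ≤ θ := (Set.uIcc_of_le hr ▸ hθ).1
    rw [abs_of_nonneg hθ0]
    exact (by simpa using ((hasDerivAt_id θ).const_mul A).const_add 1 :
      HasDerivAt (fun θ => 1 + A * θ) A θ).log (by positivity)
  have hcont : Continuous fun θ : ℝ => A / (1 + A * |θ|) :=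
    continuous_const.div (by fun_prop) fun θ => by positivity
  have heven := intervalIntegral.integral_comp_neg (a := 0) (b := r) fun θ : ℝ => A / (1 + A * |θ|)
  rw [neg_zero] at heven
  rw [← intervalIntegral.integral_add_adjacent_intervals (hcont.intervalIntegrable _ 0)
    (hcont.intervalIntegrable _ _), ← heven]
  simp only [abs_neg]
  rw [intervalIntegral.integral_eq_sub_of_hasDerivAt hderiv (hcont.intervalIntegrable _ _)]
  simp [two_mul]

lemma log_one_add_mul_pi_le {x : ℝ} (hx : 1 ≤ x) :
    Real.log (1 + x * π) ≤ 2 * (1 + Real.log x) := by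
  have hexp : 1 + π ≤ Real.exp 2 := by
    linarith [Real.pi_le_four, Real.quadratic_le_exp_of_nonneg zero_le_two]
  calc Real.log (1 + x * π) ≤ Real.log (Real.exp 2 * x) :=
        Real.log_le_log (by positivity) (by nlinarith)
    _ = 2 + Real.log x := by rw [Real.log_mul (by positivity) (by positivity), Real.log_exp]
    _ ≤ 2 * (1 + Real.log x) := by linarith [Real.log_nonneg hx]

lemma norm_sum_Icc_le_of_norm_le {c : ℕ → ℂ} {g : ℂ → ℂ} {M : ℝ} {N : ℕ} (hN : 1 ≤ N)
    (hg : ∀ w : ℂ, ‖w‖ = Real.exp (-(1 / N)) → HasSum (fun n => c n * w ^ n) (g w))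
    (hM : ∀ w : ℂ, ‖w‖ = Real.exp (-(1 / N)) → ‖g w‖ ≤ M) :
    ‖∑ n ∈ Icc 1 N, c n‖ ≤ 4 * Real.exp 2 * M * (1 + Real.log N) := by
  have hN' : (1 : ℝ) ≤ N := by exact_mod_cast hN
  have hpi := Real.pi_pos
  have hcircle (θ : ℝ) : ‖circleMap 0 (Real.exp (-(1 / N))) θ‖ = Real.exp (-(1 / N)) := by simp
  have hM0 : 0 ≤ M := (norm_nonneg _).trans (hM _ (hcircle 0))
  have hkernel : ∀ θ ∈ Set.Ioc (-π) π,
      ‖g (circleMap 0 (Real.exp (-(1 / N))) θ)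
        * ∑ m ∈ Icc 1 N, (circleMap 0 (Real.exp (-(1 / N))) θ)⁻¹ ^ m‖
      ≤ M * (2 * π * Real.exp 2) * (N / (1 + N * |θ|)) := by
    intro θ hθ
    rw [norm_mul, circleMap_zero_inv, ← Real.exp_neg, neg_neg, mul_assoc M, ← abs_neg θ]
    gcongr
    · exact hM _ (hcircle θ)
    · exact norm_sum_Icc_circleMap_pow_le hN (abs_le.2 ⟨by linarith [hθ.2], by linarith [hθ.1]⟩)
  have hcont : Continuous fun θ : ℝ => (N : ℝ) / (1 + N * |θ|) :=
    continuous_const.div (by fun_prop) fun θ => by positivity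
  rw [sum_eq_circleAverage (Real.exp_pos _) hg, circleAverage_eq_integral_neg_pi_pi, norm_smul,
    Real.norm_of_nonneg (by positivity)]
  calc _ ≤ (2 * π)⁻¹ * ∫ θ in -π..π,
        M * (2 * π * Real.exp 2) * (N / (1 + N * |θ|)) := by
        gcongr
        exact intervalIntegral.norm_integral_le_of_norm_le (by linarith) (.of_forall hkernel)
          ((hcont.const_mul _).intervalIntegrable _ _)
    _ = 2 * Real.exp 2 * M * Real.log (1 + N * π) := by
        rw [intervalIntegral.integral_const_mul,
          integral_div_one_add_mul_abs (by positivity) (by positivity)]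
        field_simp
    _ ≤ 2 * Real.exp 2 * M * (2 * (1 + Real.log N)) := by gcongr; exact log_one_add_mul_pi_le hN'
    _ = 4 * Real.exp 2 * M * (1 + Real.log N) := by ring

end GeometricKernel

section PartialSummation

lemma sum_Icc_one_mul_eq_sub_integral_mul {f : ℝ → ℂ} (c : ℕ → ℂ) (N : ℕ)
    (hf : ∀ t ∈ Set.Icc (1 : ℝ) N, DifferentiableAt ℝ f t)
    (hf' : IntegrableOn (deriv f) (Set.Icc 1 N)) :
    ∑ n ∈ Icc 1 N, f n * c n
      = f N * ∑ n ∈ Icc 1 N, c n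
        - ∫ t in Set.Ioc (1 : ℝ) N, deriv f t * ∑ n ∈ Icc 1 ⌊t⌋₊, c n := by
  have hupdate (g : ℕ → ℂ) (m : ℕ) :
      ∑ n ∈ Icc 0 m, g n * Function.update c 0 0 n = ∑ n ∈ Icc 1 m, g n * c n := by
    rw [← sum_subset (Icc_subset_Icc_left zero_le_one)]
    · exact sum_congr rfl fun n hn => by
        rw [Function.update_of_ne (by grind)]
    · intro n _ hn
      simp [show n = 0 by grind]
  have habel := sum_mul_eq_sub_integral_mul₀' (Function.update c 0 0) (by simp) N hf hf'
  have hsum (m : ℕ) : ∑ n ∈ Icc 0 m, Function.update c 0 0 n = ∑ n ∈ Icc 1 m, c n := by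
    simpa only [one_mul] using hupdate (fun _ => 1) m
  simpa only [hupdate fun n => f n, hsum] using habel

lemma hasDerivAt_ofReal_rpow_neg (β : ℝ) {t : ℝ} (ht : 1 ≤ t) :
    HasDerivAt (fun t : ℝ => ((t ^ (-β) : ℝ) : ℂ)) ((-β * t ^ (-β - 1) : ℝ) : ℂ) t :=
  (Real.hasDerivAt_rpow_const (.inl (by linarith))).ofReal_comp

lemma integrableOn_deriv_ofReal_rpow_neg (β x : ℝ) :
    IntegrableOn (deriv fun t : ℝ => ((t ^ (-β) : ℝ) : ℂ)) (Set.Icc 1 x) := by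
  have hcont : ContinuousOn (fun t : ℝ => ((-β * t ^ (-β - 1) : ℝ) : ℂ)) (Set.Icc 1 x) := by
    intro t ht
    have := ht.1
    fun_prop (disch := grind)
  exact hcont.integrableOn_Icc.congr_fun
    (fun t ht => (hasDerivAt_ofReal_rpow_neg β ht.1).deriv.symm) measurableSet_Icc

lemma setIntegral_Ioc_one_rpow_sub_one_le {x γ : ℝ} (hx : 1 ≤ x) (hγ : 0 < γ) :
    ∫ t in Set.Ioc 1 x, t ^ (γ - 1) ≤ x ^ γ / γ := by
  rw [← intervalIntegral.integral_of_le hx, integral_rpow (.inl (by linarith)), sub_add_cancel,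
    Real.one_rpow]
  gcongr
  linarith

lemma norm_setIntegral_deriv_rpow_neg_mul_le {S : ℝ → ℂ} {A σ β x : ℝ} (hx : 1 ≤ x) (hA : 0 ≤ A)
    (hβ : β < σ) (hS : ∀ t ∈ Set.Ioc 1 x, ‖S t‖ ≤ A * t ^ σ) :
    ‖∫ t in Set.Ioc 1 x, deriv (fun t : ℝ => ((t ^ (-β) : ℝ) : ℂ)) t * S t‖
      ≤ |β| * A * (x ^ (σ - β) / (σ - β)) := by
  have hbound : ∀ t ∈ Set.Ioc 1 x,
      ‖deriv (fun t : ℝ => ((t ^ (-β) : ℝ) : ℂ)) t * S t‖ ≤ |β| * A * t ^ (σ - β - 1) := by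
    intro t ht
    have ht0 : 0 < t := by linarith [ht.1]
    rw [(hasDerivAt_ofReal_rpow_neg β ht.1.le).deriv, norm_mul, Complex.norm_real, norm_mul,
      norm_neg, Real.norm_eq_abs, Real.norm_of_nonneg (by positivity)]
    calc |β| * t ^ (-β - 1) * ‖S t‖ ≤ |β| * t ^ (-β - 1) * (A * t ^ σ) := by
          gcongr
          exact hS t ht
      _ = |β| * A * t ^ (σ - β - 1) := by
          rw [show σ - β - 1 = -β - 1 + σ by ring, Real.rpow_add ht0]
          ring
  have hint : IntegrableOn (fun t : ℝ => |β| * A * t ^ (σ - β - 1)) (Set.Ioc 1 x) :=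
    ((intervalIntegral.intervalIntegrable_rpow' (by linarith)).1).const_mul _
  refine (norm_integral_le_of_norm_le hint
    ((ae_restrict_iff' measurableSet_Ioc).2 (.of_forall hbound))).trans ?_
  rw [integral_const_mul]
  gcongr
  exact setIntegral_Ioc_one_rpow_sub_one_le hx (by linarith)

lemma norm_sum_div_rpow_le {c : ℕ → ℂ} {A σ β : ℝ} {N : ℕ} (hN : 1 ≤ N) (hσ : 0 ≤ σ) (hβ : β < σ)
    (hc : ∀ m, 1 ≤ m → m ≤ N → ‖∑ n ∈ Icc 1 m, c n‖ ≤ A * (m : ℝ) ^ σ) :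
    ‖∑ n ∈ Icc 1 N, c n / (((n : ℝ) ^ β : ℝ) : ℂ)‖
      ≤ (1 + |β| / (σ - β)) * A * (N : ℝ) ^ (σ - β) := by
  have hN1 : (1 : ℝ) ≤ N := by exact_mod_cast hN
  have hA : 0 ≤ A := (norm_nonneg _).trans (by simpa using hc 1 le_rfl hN)
  have hboundary : ‖((N : ℝ) ^ (-β) : ℝ) * ∑ n ∈ Icc 1 N, c n‖ ≤ A * (N : ℝ) ^ (σ - β) := by
    rw [norm_mul, Complex.norm_real, Real.norm_of_nonneg (by positivity), mul_comm, sub_eq_add_neg,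
      Real.rpow_add (by positivity), ← mul_assoc]
    gcongr
    exact hc N hN le_rfl
  have hfloor : ∀ t ∈ Set.Ioc (1 : ℝ) N, ‖∑ n ∈ Icc 1 ⌊t⌋₊, c n‖ ≤ A * t ^ σ := by
    intro t ht
    refine (hc ⌊t⌋₊ ((Nat.one_le_floor_iff t).2 ht.1.le) (Nat.floor_le_of_le ht.2)).trans ?_
    gcongr
    exact Nat.floor_le (by linarith [ht.1])
  have hterm (n : ℕ) : c n / (((n : ℝ) ^ β : ℝ) : ℂ) = (((n : ℝ) ^ (-β) : ℝ) : ℂ) * c n := by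
    rw [Real.rpow_neg n.cast_nonneg, Complex.ofReal_inv, div_eq_inv_mul]
  simp only [hterm]
  rw [sum_Icc_one_mul_eq_sub_integral_mul c N
    (fun t ht => (hasDerivAt_ofReal_rpow_neg β ht.1).differentiableAt)
    (integrableOn_deriv_ofReal_rpow_neg β N)]
  calc _ ≤ A * (N : ℝ) ^ (σ - β) + |β| * A * ((N : ℝ) ^ (σ - β) / (σ - β)) :=
        norm_sub_le_of_le hboundary (norm_setIntegral_deriv_rpow_neg_mul_le hN1 hA hβ hfloor)
    _ = (1 + |β| / (σ - β)) * A * (N : ℝ) ^ (σ - β) := by ring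

end PartialSummation

section Residues

lemma sum_addChar_mul_conj {G : Type*} [AddCommGroup G] [Fintype G] [DecidableEq G] (r s : G) :
    ∑ ψ : AddChar G ℂ, ψ r * starRingEnd ℂ (ψ s) = if r = s then (Fintype.card G : ℂ) else 0 := by
  simp_rw [← AddChar.map_neg_eq_conj, ← AddChar.map_add_eq_mul, ← sub_eq_add_neg,
    AddChar.sum_apply_eq_ite, sub_eq_zero]

lemma sum_norm_sq_sum_mul_addChar {G : Type*} [AddCommGroup G] [Fintype G] (F : G → ℂ) :
    ∑ ψ : AddChar G ℂ, ‖∑ r, F r * ψ r‖ ^ 2 = Fintype.card G * ∑ r, ‖F r‖ ^ 2 := by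
  classical
  have hexpand (ψ : AddChar G ℂ) : (‖∑ r, F r * ψ r‖ : ℂ) ^ 2
      = ∑ r, ∑ s, F r * starRingEnd ℂ (F s) * (ψ r * starRingEnd ℂ (ψ s)) := by
    simp_rw [← Complex.mul_conj', map_sum, map_mul, sum_mul_sum, mul_mul_mul_comm]
  have hcomplex : ∑ ψ : AddChar G ℂ, (‖∑ r, F r * ψ r‖ : ℂ) ^ 2
      = Fintype.card G * ∑ r, (‖F r‖ : ℂ) ^ 2 := by
    simp_rw [hexpand]
    rw [sum_comm, mul_sum]
    refine sum_congr rfl fun r _ => ?_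
    rw [sum_comm]
    simp_rw [← mul_sum, sum_addChar_mul_conj]
    simp [Complex.mul_conj', mul_comm]
  exact_mod_cast hcomplex

lemma sum_Icc_natCast_zmod {M : Type*} [AddCommMonoid M] {q : ℕ} [NeZero q] (F : ZMod q → M) :
    ∑ h ∈ Icc 1 q, F h = ∑ r, F r := by
  refine sum_bij' (fun h _ => (h : ZMod q)) (fun r _ => (r - 1).val + 1) (by simp) (fun r _ => ?_)
    (fun h hh => ?_) (by simp) (fun _ _ => rfl)
  · exact mem_Icc.2 ⟨by lia, (r - 1).val_lt⟩
  · obtain ⟨h, rfl⟩ := Nat.exists_eq_add_of_le' (mem_Icc.1 hh).1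
    simpa using Nat.mod_eq_of_lt (mem_Icc.1 hh).2

lemma sum_norm_sq_progressionSum_le {b : ℕ → ℂ} {x M : ℝ} {q : ℕ} (hq : q ≠ 0)
    (hM : ∀ z : ℂ, ‖z‖ = 1 → ‖∑ n ∈ Icc 1 ⌊x⌋₊, b n * z ^ n‖ ≤ M) :
    ∑ h ∈ Icc 1 q, ‖progressionSum b x q h‖ ^ 2 ≤ M ^ 2 := by
  have : NeZero q := ⟨hq⟩
  set F : ZMod q → ℂ := fun r => ∑ n ∈ Icc 1 ⌊x⌋₊ with ((n : ℕ) : ZMod q) = r, b n with hF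
  have hprog (h : ℕ) : progressionSum b x q h = F h := by
    simp only [progressionSum, hF, ZMod.natCast_eq_natCast_iff]
  have hchar (ψ : AddChar (ZMod q) ℂ) :
      ∑ r, F r * ψ r = ∑ n ∈ Icc 1 ⌊x⌋₊, b n * ψ 1 ^ n := by
    simp_rw [hF, sum_mul]
    rw [← sum_fiberwise (Icc 1 ⌊x⌋₊) (fun n : ℕ => (n : ZMod q))]
    refine sum_congr rfl fun r _ => sum_congr rfl fun n hn => ?_
    rw [← (mem_filter.1 hn).2, ← AddChar.map_nsmul_eq_pow, nsmul_one]
  have hq0 : (0 : ℝ) < q := by positivity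
  refine le_of_mul_le_mul_left ?_ hq0
  calc q * ∑ h ∈ Icc 1 q, ‖progressionSum b x q h‖ ^ 2 = q * ∑ r, ‖F r‖ ^ 2 := by
        simp only [hprog, sum_Icc_natCast_zmod fun r => ‖F r‖ ^ 2]
    _ = ∑ ψ : AddChar (ZMod q) ℂ, ‖∑ r, F r * ψ r‖ ^ 2 := by
        rw [sum_norm_sq_sum_mul_addChar, ZMod.card]
    _ ≤ ∑ _ψ : AddChar (ZMod q) ℂ, M ^ 2 := by
        gcongr with ψ
        exact hchar ψ ▸ hM _ (ψ.norm_apply 1)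
    _ = q * M ^ 2 := by simp [AddChar.card_eq]

lemma card_filter_lt_norm_progressionSum_le {b : ℕ → ℂ} {x M R : ℝ} {q : ℕ} (hq : q ≠ 0)
    (hR : 0 < R) (hM : ∀ z : ℂ, ‖z‖ = 1 → ‖∑ n ∈ Icc 1 ⌊x⌋₊, b n * z ^ n‖ ≤ M) :
    (#{h ∈ Icc 1 q | R < ‖progressionSum b x q h‖} : ℝ) ≤ (M / R) ^ 2 := by
  rw [div_pow, le_div_iff₀ (by positivity), ← nsmul_eq_mul]
  calc _ ≤ ∑ h ∈ Icc 1 q with R < ‖progressionSum b x q h‖, ‖progressionSum b x q h‖ ^ 2 :=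
        card_nsmul_le_sum _ _ _ fun h hh => by gcongr; exact (mem_filter.1 hh).2.le
    _ ≤ ∑ h ∈ Icc 1 q, ‖progressionSum b x q h‖ ^ 2 :=
        sum_le_sum_of_subset_of_nonneg (filter_subset _ _) fun _ _ _ => by positivity
    _ ≤ M ^ 2 := sum_norm_sq_progressionSum_le hq hM

end Residues

/-- A bound of Wilton type for the exponential sums with coefficients `b`: the partial sums of
`∑ b n z ^ n` are `O(N ^ σ log N)` uniformly on the unit circle. It is the only input on the
coefficients that the distribution over residue classes needs. The factor `1 + log N` replaces
`log N` so that the bound is meaningful at `N = 1`. -/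
def ExpSumBound (b : ℕ → ℂ) (σ K : ℝ) : Prop :=
  ∀ N : ℕ, 1 ≤ N → ∀ z : ℂ, ‖z‖ = 1 →
    ‖∑ n ∈ Icc 1 N, b n * z ^ n‖ ≤ K * (N : ℝ) ^ σ * (1 + Real.log N)

lemma isLittleO_one_add_log_sq_rpow {ε : ℝ} (hε : 0 < ε) :
    (fun x : ℝ => (1 + Real.log x) ^ 2) =o[atTop] fun x => x ^ ε := by
  have h : (fun x : ℝ => 1 + Real.log x) =o[atTop] fun x => x ^ (ε / 2) :=
    ((Real.isLittleO_const_log_atTop (c := 1)).trans (isLittleO_log_rpow_atTop (half_pos hε))).add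
      (isLittleO_log_rpow_atTop (half_pos hε))
  refine (h.pow two_pos).congr' .rfl ?_
  filter_upwards [eventually_ge_atTop 0] with x hx
  rw [← Real.rpow_mul_natCast hx, Nat.cast_ofNat, div_mul_cancel₀ _ two_ne_zero]

namespace ExpSumBound

variable {b : ℕ → ℂ} {σ K : ℝ}

lemma const_nonneg (hb : ExpSumBound b σ K) : 0 ≤ K :=
  (norm_nonneg _).trans (by simpa using hb 1 le_rfl 1 norm_one)

lemma div_rpow {β : ℝ} (hb : ExpSumBound b σ K) (hσ : 0 ≤ σ) (hβ : β < σ) :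
    ExpSumBound (fun n => b n / (((n : ℝ) ^ β : ℝ) : ℂ)) (σ - β) ((1 + |β| / (σ - β)) * K) := by
  intro N hN z hz
  have hK := hb.const_nonneg
  have hpartial : ∀ m, 1 ≤ m → m ≤ N →
      ‖∑ n ∈ Icc 1 m, b n * z ^ n‖ ≤ K * (1 + Real.log N) * (m : ℝ) ^ σ := by
    intro m hm hmN
    refine (hb m hm z hz).trans ?_
    rw [mul_right_comm]
    gcongr
  calc ‖∑ n ∈ Icc 1 N, b n / (((n : ℝ) ^ β : ℝ) : ℂ) * z ^ n‖
      ≤ (1 + |β| / (σ - β)) * (K * (1 + Real.log N)) * (N : ℝ) ^ (σ - β) := by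
        simpa only [div_mul_eq_mul_div] using norm_sum_div_rpow_le hN hσ hβ hpartial
    _ = (1 + |β| / (σ - β)) * K * (N : ℝ) ^ (σ - β) * (1 + Real.log N) := by ring

lemma norm_sum_Icc_floor_le (hb : ExpSumBound b σ K) (hσ : 0 ≤ σ) {x : ℝ} (hx : 1 ≤ x) {z : ℂ}
    (hz : ‖z‖ = 1) :
    ‖∑ n ∈ Icc 1 ⌊x⌋₊, b n * z ^ n‖ ≤ K * x ^ σ * (1 + Real.log x) := by
  have hK := hb.const_nonneg
  have hfloor : 1 ≤ ⌊x⌋₊ := (Nat.one_le_floor_iff x).2 hx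
  have hfloor' : (⌊x⌋₊ : ℝ) ≤ x := Nat.floor_le (by linarith)
  refine (hb _ hfloor z hz).trans ?_
  gcongr

lemma eventually_card_le (hb : ExpSumBound b σ K) (hσ : 0 ≤ σ) {C ε δ : ℝ} (hC : 0 < C)
    (hε : 0 < ε) (hδ : 0 < δ) :
    ∀ᶠ x : ℝ in atTop, ∀ q : ℕ, x ^ (1 / 2 + ε) ≤ q →
      (#{h ∈ Icc 1 q | C * x ^ (σ - 1 / 4) < ‖progressionSum b x q h‖} : ℝ) ≤ δ * q := by
  filter_upwards [((isLittleO_one_add_log_sq_rpow hε).const_mul_left ((K / C) ^ 2)).def hδ,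
    eventually_ge_atTop 1] with x hlog hx q hq
  have hx0 : 0 < x := by linarith
  have hq0 : q ≠ 0 := by
    rintro rfl
    exact absurd hq (by simpa using Real.rpow_pos_of_pos hx0 _)
  rw [Real.norm_of_nonneg (by positivity), Real.norm_of_nonneg (by positivity)] at hlog
  have hratio : K * x ^ σ * (1 + Real.log x) / (C * x ^ (σ - 1 / 4))
      = K / C * (1 + Real.log x) * x ^ (1 / 4 : ℝ) := by
    rw [Real.rpow_sub hx0]
    field_simp
  have hsqrt : (x ^ (1 / 4 : ℝ)) ^ 2 = x ^ (1 / 2 : ℝ) := by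
    rw [← Real.rpow_mul_natCast hx0.le]
    norm_num
  calc _ ≤ (K * x ^ σ * (1 + Real.log x) / (C * x ^ (σ - 1 / 4))) ^ 2 :=
        card_filter_lt_norm_progressionSum_le hq0 (by positivity)
          fun z hz => hb.norm_sum_Icc_floor_le hσ hx hz
    _ = (K / C) ^ 2 * (1 + Real.log x) ^ 2 * x ^ (1 / 2 : ℝ) := by
        rw [hratio, mul_pow, mul_pow, hsqrt]
    _ ≤ δ * x ^ ε * x ^ (1 / 2 : ℝ) := by gcongr
    _ = δ * x ^ (1 / 2 + ε) := by rw [add_comm, Real.rpow_add hx0, mul_assoc]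
    _ ≤ δ * q := by gcongr

end ExpSumBound

section FourierSeries

lemma exists_qParam_eq {w : ℂ} {y : ℝ} (hy : 0 < y) (hw : ‖w‖ = Real.exp (-(2 * π * y))) :
    ∃ τ : ℍ, τ.im = y ∧ Complex.exp (2 * π * Complex.I * τ) = w := by
  have hw0 : w ≠ 0 := norm_ne_zero_iff.1 (by rw [hw]; positivity)
  have him : (Function.Periodic.invQParam 1 w).im = y := by
    rw [Function.Periodic.im_invQParam, hw, Real.log_exp]
    field_simp
  refine ⟨⟨Function.Periodic.invQParam 1 w, him ▸ hy⟩, him, ?_⟩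
  simpa [Function.Periodic.qParam] using Function.Periodic.qParam_right_inv one_ne_zero hw0

lemma hasSum_nat_of_hasSum_pnat {a : ℕ → ℂ} {τ : ℍ} {s : ℂ}
    (h : HasSum (fun n : ℕ+ => a n * Complex.exp (2 * π * Complex.I * (n : ℂ) * (τ : ℂ))) s) :
    HasSum (fun n : ℕ => Function.update a 0 0 n * Complex.exp (2 * π * Complex.I * τ) ^ n) s := by
  rw [← PNat.coe_injective.hasSum_iff fun n hn => ?_]
  · convert h using 2 with n
    rw [Function.comp_apply, Function.update_of_ne n.ne_zero, ← Complex.exp_nat_mul]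
    ring_nf
  · have hn0 : n = 0 := by
      by_contra hn0
      exact hn ⟨⟨n, Nat.pos_of_ne_zero hn0⟩, rfl⟩
    rw [hn0, Function.update_self, zero_mul]

lemma expSumBound_of_norm_le {f : ℍ → ℂ} {a : ℕ → ℂ} {B σ : ℝ}
    (hf : ∀ τ : ℍ,
      HasSum (fun n : ℕ+ => a n * Complex.exp (2 * π * Complex.I * (n : ℂ) * (τ : ℂ))) (f τ))
    (hB : ∀ τ : ℍ, ‖f τ‖ ≤ B * τ.im ^ (-σ)) :
    ExpSumBound a σ (4 * Real.exp 2 * (2 * π) ^ σ * B) := by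
  intro N hN z hz
  have hy : (0 : ℝ) < 1 / (2 * π * N) := by positivity
  have hlift : ∀ w : ℂ, ∃ τ : ℍ, ‖w‖ = Real.exp (-(1 / N)) →
      τ.im = 1 / (2 * π * N) ∧ Complex.exp (2 * π * Complex.I * τ) = z * w := by
    intro w
    by_cases hw : ‖w‖ = Real.exp (-(1 / N))
    · obtain ⟨τ, hτ⟩ := exists_qParam_eq (w := z * w) hy
        (by rw [norm_mul, hz, one_mul, hw]; field_simp)
      exact ⟨τ, fun _ => hτ⟩
    · exact ⟨I, fun h => absurd h hw⟩
  choose τ hτ using hlift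
  have hsum := norm_sum_Icc_le_of_norm_le (g := fun w => f (τ w))
    (c := fun n => Function.update a 0 0 n * z ^ n) (M := B * (1 / (2 * π * N)) ^ (-σ)) hN
    (fun w hw => ?_) (fun w hw => ?_)
  · calc ‖∑ n ∈ Icc 1 N, a n * z ^ n‖ = ‖∑ n ∈ Icc 1 N, Function.update a 0 0 n * z ^ n‖ := by
          congr 1
          exact sum_congr rfl fun n hn => by rw [Function.update_of_ne (by grind)]
      _ ≤ _ := hsum
      _ = _ := by
        rw [one_div, Real.inv_rpow (by positivity), Real.rpow_neg (by positivity), inv_inv,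
          Real.mul_rpow (by positivity) (by positivity)]
        ring
  · have hseries := hasSum_nat_of_hasSum_pnat (hf (τ w))
    rw [(hτ w hw).2] at hseries
    simpa only [mul_pow, mul_assoc] using hseries
  · exact (hτ w hw).1 ▸ hB (τ w)

end FourierSeries

namespace IsCuspFormWithCoeffs

variable {k : ℝ} {f : ℍ → ℂ} {a : ℕ → ℂ}

lemma apply_one_vadd (hf : IsCuspFormWithCoeffs k f a) (τ : ℍ) : f ((1 : ℝ) +ᵥ τ) = f τ := by
  refine (hf.fourier _).unique ?_
  convert hf.fourier τ using 3 with n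
  rw [coe_vadd, Complex.exp_eq_exp_iff_exists_int]
  exact ⟨n, by push_cast; ring⟩

lemma periodic_comp_ofComplex (hf : IsCuspFormWithCoeffs k f a) :
    Function.Periodic (f ∘ ofComplex) ((1 : ℝ) : ℂ) := by
  intro w
  by_cases! hw : 0 < w.im
  · have hw' : 0 < (w + (1 : ℝ)).im := by simpa using hw
    simp only [Function.comp_apply, ofComplex_apply_of_im_pos hw, ofComplex_apply_of_im_pos hw',
      ← hf.apply_one_vadd ⟨w, hw⟩]
    congr 1
    ext1
    simp [add_comm]
  · have hw' : (w + (1 : ℝ)).im ≤ 0 := by simpa using hw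
    simp only [Function.comp_apply, ofComplex_apply_of_im_nonpos hw,
      ofComplex_apply_of_im_nonpos hw']

lemma norm_S_smul_mul_im_rpow (hf : IsCuspFormWithCoeffs k f a) (τ : ℍ) :
    ‖f (ModularGroup.S • τ)‖ * (ModularGroup.S • τ).im ^ (k / 2) = ‖f τ‖ * τ.im ^ (k / 2) := by
  obtain ⟨A, hA, hS⟩ := hf.modular ModularGroup.S (by simp [ModularGroup.S])
  have hτ : 0 < ‖(τ : ℂ)‖ := norm_pos_iff.2 τ.ne_zero
  have hfactor : ‖f (ModularGroup.S • τ)‖ = ‖(τ : ℂ)‖ ^ k * ‖f τ‖ := by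
    rw [hS, norm_mul, norm_mul, hA, Complex.norm_cpow_real]
    simp [ModularGroup.S]
  have him : (ModularGroup.S • τ).im = τ.im / ‖(τ : ℂ)‖ ^ 2 := by
    rw [modular_S_smul]
    simp [Complex.inv_im, Complex.normSq_eq_norm_sq, neg_div]
  rw [hfactor, him, Real.div_rpow τ.im_pos.le (by positivity), ← Real.rpow_natCast_mul hτ.le,
    Nat.cast_ofNat, mul_div_cancel₀ k two_ne_zero]
  field_simp

lemma norm_smul_mul_im_rpow (hf : IsCuspFormWithCoeffs k f a) (γ : SL(2, ℤ)) (τ : ℍ) :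
    ‖f (γ • τ)‖ * (γ • τ).im ^ (k / 2) = ‖f τ‖ * τ.im ^ (k / 2) := by
  have hγ : γ ∈ Subgroup.closure {ModularGroup.S, ModularGroup.T} := by
    simp [SpecialLinearGroup.SL2Z_generators]
  induction hγ using Subgroup.closure_induction generalizing τ with
  | mem γ hγ =>
    rcases hγ with rfl | rfl
    · exact hf.norm_S_smul_mul_im_rpow τ
    · rw [modular_T_smul, hf.apply_one_vadd, vadd_im]
  | one => simp
  | mul γ₁ γ₂ _ _ h₁ h₂ => rw [mul_smul, h₁, h₂]
  | inv γ _ h => rw [← h (γ⁻¹ • τ), smul_inv_smul]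

lemma isBoundedAtImInfty_norm_mul_im_rpow (hf : IsCuspFormWithCoeffs k f a) (s : ℝ) :
    IsBoundedAtImInfty fun τ : ℍ => ‖f τ‖ * τ.im ^ s := by
  have hdecay := hf.zero_at_infty.exp_decay_atImInfty one_pos hf.periodic_comp_ofComplex
    hf.holomorphic hf.zero_at_infty.isBoundedAtImInfty
  have hexp : (fun y : ℝ => Real.exp (-2 * π * y / 1) * y ^ s) =O[atTop] (1 : ℝ → ℝ) := by
    refine ((tendsto_rpow_mul_exp_neg_mul_atTop_nhds_zero s (2 * π)
      (by positivity)).isBigO_one ℝ).congr_left fun y => ?_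
    rw [mul_comm, div_one, neg_mul, neg_mul, neg_mul]
  exact (hdecay.norm_left.mul (Asymptotics.isBigO_refl _ _)).trans
    (hexp.comp_tendsto tendsto_comap)

lemma exists_norm_le (hf : IsCuspFormWithCoeffs k f a) :
    ∃ B : ℝ, ∀ τ : ℍ, ‖f τ‖ ≤ B * τ.im ^ (-(k / 2)) := by
  have hcont : Continuous fun τ : ℍ => ‖f τ‖ * τ.im ^ (k / 2) :=
    hf.holomorphic.continuous.norm.mul (continuous_im.rpow_const fun τ => .inl τ.im_ne_zero)
  obtain ⟨B, hB⟩ := ModularGroup.exists_bound_of_invariant hcont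
    (hf.isBoundedAtImInfty_norm_mul_im_rpow _) hf.norm_smul_mul_im_rpow
  refine ⟨B, fun τ => ?_⟩
  have him : 0 < τ.im ^ (k / 2) := Real.rpow_pos_of_pos τ.im_pos _
  rw [Real.rpow_neg τ.im_pos.le, ← div_eq_mul_inv, le_div_iff₀ him]
  exact (Real.le_norm_self _).trans (hB τ)

lemma exists_expSumBound (hf : IsCuspFormWithCoeffs k f a) : ∃ K, ExpSumBound a (k / 2) K :=
  let ⟨_, hB⟩ := hf.exists_norm_le
  ⟨_, expSumBound_of_norm_le hf.fourier hB⟩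

end IsCuspFormWithCoeffs

lemma card_exceptionalResidues_le (k : ℝ) (a : ℕ → ℂ) (C x : ℝ) (q : ℕ) :
    (exceptionalResidues k a C x q).card
      ≤ #{h ∈ Icc 1 q | C * x ^ (1 / 4 : ℝ) < ‖progressionSum (normalizedCoeff k a) x q h‖}
        + #{h ∈ Icc 1 q | C * x ^ (k / 2 - 1 / 4) < ‖progressionSum a x q h‖} := by
  simp only [exceptionalResidues, not_and_or, not_le, filter_or]
  exact card_union_le _ _

theorem mainTheorem9_general {k : ℝ} {f : ℍ → ℂ} {a : ℕ → ℂ} (hf : IsCuspFormWithCoeffs k f a)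
    {C ε δ : ℝ} (hC : 0 < C) (hε : 0 < ε) (hδ : 0 < δ) :
    ∀ᶠ x : ℝ in atTop, ∀ q : ℕ, x ^ (1 / 2 + ε) ≤ q →
      ((exceptionalResidues k a C x q).card : ℝ) ≤ δ * q := by
  obtain ⟨K, hK⟩ := hf.exists_expSumBound
  have hσ : 0 ≤ k / 2 := by linarith [hf.weight_pos]
  have hnormalized := hK.div_rpow (β := (k - 1) / 2) hσ (by linarith)
  have hexponent : k / 2 - (k - 1) / 2 - 1 / 4 = 1 / 4 := by ring
  filter_upwards [hnormalized.eventually_card_le (by linarith) hC hε (half_pos hδ),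
    hK.eventually_card_le hσ hC hε (half_pos hδ)] with x hx₁ hx₂ q hq
  have hcard₁ := hx₁ q hq
  rw [hexponent] at hcard₁
  calc ((exceptionalResidues k a C x q).card : ℝ)
      ≤ #{h ∈ Icc 1 q | C * x ^ (1 / 4 : ℝ) < ‖progressionSum (normalizedCoeff k a) x q h‖}
        + #{h ∈ Icc 1 q | C * x ^ (k / 2 - 1 / 4) < ‖progressionSum a x q h‖} :=
        mod_cast card_exceptionalResidues_le k a C x q
    _ ≤ δ / 2 * q + δ / 2 * q := add_le_add hcard₁ (hx₂ q hq)
    _ = δ * q := by ring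

theorem mainTheorem9 (k : ℝ) (f : UpperHalfPlane → ℂ) (a : ℕ → ℂ)
    (hf : IsCuspFormWithCoeffs k f a) :
    ∃ C : ℝ, 0 < C ∧ ∀ ε : ℝ, 0 < ε → ∀ δ : ℝ, 0 < δ →
      ∃ x₀ : ℝ, ∀ x : ℝ, x₀ ≤ x → ∀ q : ℕ, x ^ (1 / 2 + ε) ≤ (q : ℝ) → (q : ℝ) ≤ x →
        ((exceptionalResidues k a C x q).card : ℝ) ≤ δ * (q : ℝ) :=
  ⟨1, one_pos, fun _ hε _ hδ => (eventually_atTop.1 (mainTheorem9_general hf one_pos hε hδ)).imp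
    fun _ h x hx q hq _ => h x hx q hq⟩
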